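/- Consider a downlink cellular network with $M$ base stations (BSs) and $K$ user equipments (UEs). Each UE $j\in[K]$ is associated with one BS $i(j)\in[M]$; let $\mathcal K_i=\{j: i(j)=i\}$. Each BS $i$ has selected one of its UEs, $j(i)\in\mathcal K_i$ (the selection is fixed but arbitrary). Let $p_{j,i}$ be the transmit power of BS $i$ to UE $j\in\mathcal K_i$, $\mathbf p_i=(p_{j,i})_{j\in\mathcal K_i}$, let $p_i^{\max}\ge 0$ be the peak power of BS $i$, $W>0$ the bandwidth, $\sigma^2=N_0W$ with $N_0>0$ the noise power, $\eta\ge 2$ the path-loss factor, $d_{j,i}>0$ the distance and $h_{j,i}\in\mathbb R$ the channel gain between BS $i$ and UE $j$, and $\mathcal B(j)\ni i(j)$ the set of BSs whose signals reach UE $j$. The antenna gains are $G^{\rm BS}_{j,i}=G^{\rm BS}(\theta^{\rm BS}_{j,i})$ and $G^{\rm UE}_{j,i}=G^{\rm UE}(\theta^{\rm UE}_{j,i})$, where $\theta^{\rm BS}_{j,i},\theta^{\rm UE}_{j,i}\in\mathbb R$ are the angles off the beam centers and each of $G^{\rm BS},G^{\rm UE}$ is a sectorized gain with beam width $\Delta\theta\in(0,2\pi]$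 and main to side-lobe ratio $D>0$ (each with its own parameters): $G(\theta)=DG^{\min}$ if $|\theta|\le\Delta\theta/2$ and $G(\theta)=G^{\min}$ otherwise, with $G^{\min}=((D-1)\Delta\theta+2\pi)^{-1}$. Put $c_{j,\ell}=G^{\rm UE}_{j,\ell}G^{\rm BS}_{j,\ell}|h_{j,\ell}|^2d_{j,\ell}^{-\eta}$ and, for $j\in\mathcal K_i$, $$\mathrm{SINR}_{j,i}=\frac{c_{j,i}\,p_{j,i}}{\sum_{\ell\in\mathcal B(j)\setminus\{i\}}c_{j,\ell}\,p_{j(\ell),\ell}+\sigma^2}.$$ In the power-allocation game $\mathcal G$ the players are the BSs, the action space of BS $i$ is $$\mathcal P_i=\Big\{\mathbf p_i\in\mathbb R^{\mathcal K_i}: 0\le\sum_{j\in\mathcal K_i}p_{j,i}\le p_i^{\max},\ p_{j,i}\ge 0\ \ \forall j\in\mathcal K_i\Big\},$$ and its payoff, with pricing factors $\alpha_i,\lambda_i$, is $$\phi_i(\mathbf p_i,\mathbf p_{-i})=\alpha_i\sum_{j\in\mathcal K_i}W\log(1+\mathrm{SINR}_{j,i})-\lambda_i\sum_{j\in\mathcal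 K_i}p_{j,i}.$$ Then for all pricing factors $\alpha_i,\lambda_i\ge 0$ ($i\in[M]$) and every channel realization $(h_{j,i})$, the game $\mathcal G$ has at least one pure-strategy Nash equilibrium, i.e. a profile $(\mathbf p_i^\star)_{i\in[M]}$ with $\mathbf p_i^\star\in\mathcal P_i$ and $\phi_i(\mathbf p_i^\star,\mathbf p_{-i}^\star)\ge\phi_i(\mathbf p_i,\mathbf p_{-i}^\star)$ for all $i\in[M]$ and all $\mathbf p_i\in\mathcal P_i$. The same holds for the game in which each BS $i$ can only serve its selected UE, i.e. with $\mathcal P_i$ replaced by $\{\mathbf p_i\in\mathcal P_i: p_{j,i}=0\ \ \forall j\in\mathcal K_i\setminus\{j(i)\}\}$. -/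

import Mathlib

noncomputable section

/-- A strategic-form game. Player `i` picks a point of its action set `actions i`, and receives
the real payoff `payoff i s` under the profile `s`. -/
structure StrategicGame (ι : Type) (X : ι → Type) where
  actions : (i : ι) → Set (X i)
  payoff : ι → ((i : ι) → X i) → ℝ

namespace StrategicGame

variable {ι : Type} [DecidableEq ι] {X : ι → Type}

/-- The strategy of player `i` in `s` is a best response to the strategies of the other players:
it is an admissible action, and it maximizes the payoff of `i` over all its admissible actions
when the strategies of the other players are kept. -/
def IsBestResponse (G : StrategicGame ι X) (s : (i : ι) → X i) (i : ι) : Prop :=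
  s i ∈ G.actions i ∧
    ∀ x ∈ G.actions i, G.payoff i (Function.update s i x) ≤ G.payoff i s

/-- A pure-strategy Nash equilibrium: everyone plays a best response. -/
def IsPureNash (G : StrategicGame ι X) (s : (i : ι) → X i) : Prop :=
  ∀ i, G.IsBestResponse s i

end StrategicGame

/-- A keyhole (sectorized) antenna with total radiated power `1`, given by its beam width (in
radian) and by its main to side-lobe ratio. -/
structure SectorAntenna where
  /-- beam width `Δθ` -/
  width : ℝ
  /-- main to side-lobe ratio `D` -/
  ratio : ℝ
  width_pos : 0 < width
  width_le : width ≤ 2 * Real.pi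
  ratio_pos : 0 < ratio

namespace SectorAntenna

/-- side-lobe gain -/
def minGain (A : SectorAntenna) : ℝ := ((A.ratio - 1) * A.width + 2 * Real.pi)⁻¹

/-- main-lobe gain -/
def maxGain (A : SectorAntenna) : ℝ := A.ratio * A.minGain

open Classical in
/-- gain in the direction that is at the angle `θ` from the beam center -/
def gain (A : SectorAntenna) (θ : ℝ) : ℝ :=
  if |θ| ≤ A.width / 2 then A.maxGain else A.minGain

end SectorAntenna

/-- A downlink network with `M` base stations (BSs) and `K` user equipments (UEs), apart from the
random channel gains. -/
structure Network (M K : ℕ) where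
  /-- the BS `i(j)` with which UE `j` is associated -/
  serving : Fin K → Fin M
  /-- the set of BSs whose signals reach UE `j` -/
  interferers : Fin K → Finset (Fin M)
  serving_mem : ∀ j, serving j ∈ interferers j
  /-- bandwidth -/
  W : ℝ
  W_pos : 0 < W
  /-- noise power spectrum density -/
  N₀ : ℝ
  N₀_pos : 0 < N₀
  /-- path-loss factor -/
  η : ℝ
  two_le_η : 2 ≤ η
  /-- distance between UE `j` and BS `i` -/
  dist : Fin K → Fin M → ℝ
  dist_pos : ∀ j i, 0 < dist j i
  /-- the antenna of every BS -/
  antennaBS : SectorAntenna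
  /-- the antenna of every UE -/
  antennaUE : SectorAntenna
  /-- angle of UE `j` off the center of the beam of BS `i` -/
  angleBS : Fin K → Fin M → ℝ
  /-- angle of BS `i` off the center of the beam of UE `j` -/
  angleUE : Fin K → Fin M → ℝ
  /-- peak power of BS `i` -/
  pmax : Fin M → ℝ
  pmax_nonneg : ∀ i, 0 ≤ pmax i

namespace Network

variable {M K : ℕ} (N : Network M K)

/-- the UEs associated with BS `i` -/
abbrev UEs (i : Fin M) : Type := {j : Fin K // N.serving j = i}

/-- A power profile of all BSs: `p i j` is the transmit power of BS `i` to its UE `j`. -/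
abbrev Profile : Type := (i : Fin M) → N.UEs i → ℝ

/-- A schedule: for each BS `i` the UE `j(i)`, among those associated with `i`, which it serves. -/
abbrev Schedule : Type := (i : Fin M) → N.UEs i

/-- total noise power `σ² = N₀ W` -/
def noise : ℝ := N.N₀ * N.W

/-- `G^UE_{j,i} G^BS_{j,i} |h_{j,i}|² d_{j,i}^{-η}`, for the channel realization `h` -/
def linkGain (h : Fin K → Fin M → ℝ) (j : Fin K) (i : Fin M) : ℝ :=
  N.antennaUE.gain (N.angleUE j i) * N.antennaBS.gain (N.angleBS j i) *
    |h j i| ^ 2 * N.dist j i ^ (-N.η)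

/-- The equivalent channel gain `g_{j,i}` between BS `i` and its UE `j`, where each interfering
BS `ℓ ≠ i` transmits to the UE `sel ℓ`. -/
def equivGain (sel : N.Schedule) (h : Fin K → Fin M → ℝ) (p : N.Profile) (i : Fin M)
    (j : N.UEs i) : ℝ :=
  N.linkGain h j i /
    (∑ ℓ ∈ (N.interferers j).erase i, p ℓ (sel ℓ) * N.linkGain h j ℓ + N.noise)

/-- signal-to-interference-plus-noise ratio at the UE `j` of BS `i` -/
def sinr (sel : N.Schedule) (h : Fin K → Fin M → ℝ) (p : N.Profile) (i : Fin M)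
    (j : N.UEs i) : ℝ :=
  N.equivGain sel h p i j * p i j

/-- The action space of BS `i`: nonnegative powers whose sum is at most the peak power. -/
def powerSet (i : Fin M) : Set (N.UEs i → ℝ) :=
  {q | (0 ≤ ∑ j, q j ∧ ∑ j, q j ≤ N.pmax i) ∧ ∀ j, 0 ≤ q j}

/-- The payoff of BS `i`, with pricing factors `α i` and `lam i`. -/
def payoff (sel : N.Schedule) (h : Fin K → Fin M → ℝ) (α lam : Fin M → ℝ) (i : Fin M)
    (p : N.Profile) : ℝ :=
  α i * (∑ j : N.UEs i, N.W * Real.log (1 + N.sinr sel h p i j)) - lam i * ∑ j : N.UEs i, p i j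

/-- The power-allocation game with the full action spaces. -/
def powerGame (sel : N.Schedule) (h : Fin K → Fin M → ℝ) (α lam : Fin M → ℝ) :
    StrategicGame (Fin M) (fun i => N.UEs i → ℝ) where
  actions := N.powerSet
  payoff := N.payoff sel h α lam

/-- The same game when each BS `i` may transmit to no UE but the scheduled `sel i`. -/
def scheduledGame (sel : N.Schedule) (h : Fin K → Fin M → ℝ) (α lam : Fin M → ℝ) :
    StrategicGame (Fin M) (fun i => N.UEs i → ℝ) where
  actions := fun i => {q | q ∈ N.powerSet i ∧ ∀ j, j ≠ sel i → q j = 0}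
  payoff := N.payoff sel h α lam

end Network

end

/-!
The action sets are nonempty, compact and convex, and the payoffs are continuous and concave in the
own powers: the interference that a base station faces does not depend on its own powers, so that
its payoff is a nonnegative combination of logarithms of affine functions minus a linear function.
Hence both games are instances of `StrategicGame.exists_isPureNash`, the existence theorem for
concave games.

That theorem is reduced to Brouwer's fixed point theorem on a simplex by the function of Nikaido and
Isoda, `StrategicGame.totalGain`: its value at `(s, y)` is the sum of the gains that the players get
by changing, each one alone, from `s` to `y`. It is continuous in `s`, concave in `y`, and zero for
`y = s`, whereas every `s` that is not an equilibrium has a `y` with a positive value.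

Brouwer's theorem `exists_fixed_point_stdSimplex` follows from a lemma of Scarf,
`Scarf.exists_dominant_colorful`, which plays the role of Sperner's lemma and needs no
triangulation: the lattice points of a simplex, ranked by each of their coordinates, take the place
of the vertices, and the dominant sets that of the cells. One slack point per coordinate, the lowest
one in the ranking of that coordinate and of that colour, stands for the face where the coordinate
vanishes. Scarf's lemma holds by parity: fix a colour, and count the pairs of a cell and a facet of
it on which all other colours occur. Each such facet lies in two cells, except for a single one,
which consists of slack points and lies in one
(`Scarf.exists_two_extensions`, `Scarf.exists_unique_extension`), while a cell that misses a colour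
has none or two of them (`Scarf.even_card_facets`).
-/

open Filter Topology

/-! ### Scarf's combinatorial lemma -/

namespace Scarf

variable {V I κ : Type*} [LinearOrder κ]

/-- A finite set `σ` is dominant for the family `key` of rankings if no point of `V` lies strictly
above all the minima of `σ`: for every `y` there is a ranking in which `y` is at most every
element of `σ`. -/
def Dominant (key : I → V → κ) (σ : Finset V) : Prop :=
  ∀ y, ∃ i, ∀ x ∈ σ, key i y ≤ key i x

lemma Dominant.mono {key : I → V → κ} {σ τ : Finset V} (h : Dominant key σ) (hτ : τ ⊆ σ) :
    Dominant key τ := fun y => (h y).imp fun _ hi x hx => hi x (hτ hx)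

variable [DecidableEq V] [Fintype I] [DecidableEq I]

/-- A set `σ` that misses a colour has an even number of facets on which the colours other
than `k`, and no others, occur: if there is one, two points of `σ` share a colour, and such a facet
omits one of these two. -/
lemma even_card_facets {c : V → I} {k : I} {σ : Finset V} (hσ : σ.card = Fintype.card I)
    (hc : ¬ ∀ i, ∃ x ∈ σ, c x = i) (D : Finset (Finset V))
    (hD : ∀ τ, τ ⊆ σ → (τ ∈ D ↔ τ.card + 1 = Fintype.card I ∧ τ.image c = Finset.univ.erase k)) :
    Even (D.filter (· ⊆ σ)).card := by
  rcases (D.filter (· ⊆ σ)).eq_empty_or_nonempty with h0 | ⟨τ, hτ⟩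
  · simp [h0]
  obtain ⟨hτD, hτσ⟩ := Finset.mem_filter.1 hτ
  obtain ⟨hτcard, hτc⟩ := (hD τ hτσ).1 hτD
  have hcσ : σ.card = τ.card + 1 := by omega
  obtain ⟨x, hxτ, rfl⟩ : ∃ x, x ∉ τ ∧ insert x τ = σ := by
    have h1 : (σ \ τ).card = 1 := by
      rw [Finset.card_sdiff_of_subset hτσ]; omega
    obtain ⟨x, hx⟩ := Finset.card_eq_one.1 h1
    have hx' : x ∈ σ \ τ := by simp [hx]
    refine ⟨x, (Finset.mem_sdiff.1 hx').2, ?_⟩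
    rw [← Finset.singleton_union, ← hx, Finset.sdiff_union_of_subset hτσ]
  have hmem : ∀ i, i ≠ k → ∃ y ∈ τ, c y = i := fun i hi => by
    have : i ∈ τ.image c := by rw [hτc]; simp [hi]
    simpa using this
  have hcx : c x ≠ k := by
    rintro rfl
    refine hc fun i => ?_
    by_cases hi : i = c x
    · exact ⟨x, Finset.mem_insert_self _ _, hi.symm⟩
    · obtain ⟨y, hy, h⟩ := hmem i hi
      exact ⟨y, Finset.mem_insert_of_mem hy, h⟩
  obtain ⟨z, hzτ, hz⟩ := hmem _ hcx
  have hinj : Set.InjOn c τ := by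
    rw [← Finset.card_image_iff, hτc, Finset.card_erase_of_mem (Finset.mem_univ k),
      Finset.card_univ]
    omega
  have hxz : x ≠ z := fun h => hxτ (h ▸ hzτ)
  have hset : D.filter (· ⊆ insert x τ) = {τ, (insert x τ).erase z} := by
    ext ρ
    simp only [Finset.mem_filter, Finset.mem_insert, Finset.mem_singleton]
    constructor
    · rintro ⟨hρD, hρ⟩
      obtain ⟨hρcard, hρc⟩ := (hD ρ hρ).1 hρD
      by_cases hxρ : x ∈ ρ
      · right
        have hzρ : z ∉ ρ := by
          intro hzρ
          -- Otherwise `c` would take on `ρ` one colour fewer than on `τ`.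
          have hle : (ρ.image c).card ≤ (ρ.erase x).card := by
            refine (Finset.card_le_card ?_).trans (Finset.card_image_le (s := ρ.erase x) (f := c))
            intro i hi
            obtain ⟨y, hy, rfl⟩ := Finset.mem_image.1 hi
            by_cases hyx : y = x
            · rw [hyx, ← hz]
              exact Finset.mem_image_of_mem _ (Finset.mem_erase.2 ⟨hxz.symm, hzρ⟩)
            · exact Finset.mem_image_of_mem _ (Finset.mem_erase.2 ⟨hyx, hy⟩)
          rw [hρc, ← hτc, Finset.card_image_of_injOn hinj] at hle
          have := Finset.card_erase_add_one hxρ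
          omega
        refine Finset.eq_of_subset_of_card_le
          (fun y hy => Finset.mem_erase.2 ⟨fun h => hzρ (h ▸ hy), hρ hy⟩) ?_
        rw [Finset.card_erase_of_mem (Finset.mem_insert_of_mem hzτ)]
        omega
      · left
        refine Finset.eq_of_subset_of_card_le (fun y hy => ?_) (by omega)
        exact (Finset.mem_insert.1 (hρ hy)).resolve_left fun h => hxρ (h ▸ hy)
    · rintro (rfl | rfl)
      · exact ⟨hτD, hτσ⟩
      · refine ⟨(hD _ (Finset.erase_subset _ _)).2 ⟨?_, ?_⟩, Finset.erase_subset _ _⟩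
        · rw [Finset.card_erase_add_one (Finset.mem_insert_of_mem hzτ), hσ]
        · rw [← hτc]
          ext i
          simp only [Finset.mem_image, Finset.mem_erase, Finset.mem_insert]
          constructor
          · rintro ⟨y, ⟨hyz, rfl | hy⟩, rfl⟩
            · exact ⟨z, hzτ, hz⟩
            · exact ⟨y, hy, rfl⟩
          · rintro ⟨y, hy, rfl⟩
            by_cases hyz : y = z
            · exact ⟨x, ⟨hxz, Or.inl rfl⟩, by rw [hyz, hz]⟩
            · exact ⟨y, ⟨hyz, Or.inr hy⟩, rfl⟩
  rw [hset, Finset.card_pair]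
  · exact even_two
  · intro h
    exact (Finset.notMem_erase z (insert x τ)) (h ▸ hzτ)

variable [Fintype V]

/-- A dominant set `τ` with one element fewer than there are rankings extends to a dominant set by
one further point in exactly two ways, unless it consists of slack points `e i` only. Its map
`i ↦ min_i τ` identifies exactly one pair `a ≠ b`, and for `k = a` and for `k = b` the point to add
is the `k`-largest one among those that are above the `l`-minimum of `τ` for all `l ≠ k`. -/
lemma exists_two_extensions {key : I → V → κ} (hinj : ∀ i, Function.Injective (key i)) {e : I → V}
    (hmax : ∀ i l v, l ≠ i → v ∉ Set.range e → key i v < key i (e l))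
    {τ : Finset V} (hτ : Dominant key τ) (hcard : τ.card + 1 = Fintype.card I)
    {t : V} (htτ : t ∈ τ) (hte : t ∉ Set.range e) :
    ∃ y z, y ≠ z ∧ ∀ v, (v ∉ τ ∧ Dominant key (insert v τ)) ↔ v = y ∨ v = z := by
  have hm : ∀ i, ∃ x ∈ τ, ∀ y ∈ τ, key i x ≤ key i y := fun i =>
    τ.exists_min_image (key i) ⟨t, htτ⟩
  choose m hmτ hmle using hm
  have hsurj : ∀ x ∈ τ, ∃ i, m i = x := fun x hx => by
    obtain ⟨i, hi⟩ := hτ x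
    exact ⟨i, hinj i (le_antisymm (hmle i x hx) (hi _ (hmτ i)))⟩
  -- Two rankings cannot be spared at the same time.
  have hspare : ∀ k l, k ≠ l → ¬ ∀ x ∈ τ, ∃ i, i ≠ k ∧ i ≠ l ∧ m i = x := by
    intro k l hkl h
    have hsub : τ ⊆ (((Finset.univ.erase k).erase l)).image m := by
      intro x hx
      obtain ⟨i, hik, hil, rfl⟩ := h x hx
      exact Finset.mem_image_of_mem _ (by simp [hik, hil])
    have h1 := (Finset.card_le_card hsub).trans Finset.card_image_le
    have h2 : ((Finset.univ.erase k).erase l).card + 1 = (Finset.univ.erase k).card :=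
      Finset.card_erase_add_one (by simp [hkl.symm])
    have h3 : (Finset.univ.erase k).card + 1 = (Finset.univ : Finset I).card :=
      Finset.card_erase_add_one (Finset.mem_univ k)
    rw [Finset.card_univ] at h3
    omega
  obtain ⟨a, -, b, -, hab, hmab⟩ := Finset.exists_ne_map_eq_of_card_lt_of_maps_to
    (s := (Finset.univ : Finset I)) (t := τ) (f := m)
    (by rw [Finset.card_univ]; omega) (fun i _ => hmτ i)
  have hpair : ∀ k, (k = a ∨ k = b) ↔ ∀ x ∈ τ, ∃ l, l ≠ k ∧ m l = x := by
    intro k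
    constructor
    · intro hk x hx
      obtain ⟨l, rfl⟩ := hsurj x hx
      by_cases hl : l = k
      · rcases hk with rfl | rfl
        · exact ⟨b, hab.symm, by rw [hl, hmab]⟩
        · exact ⟨a, hab, by rw [hl, hmab]⟩
      · exact ⟨l, hl, rfl⟩
    · intro h
      by_contra! hk
      refine hspare k a hk.1 fun x hx => ?_
      obtain ⟨l, hl, rfl⟩ := h x hx
      by_cases hla : l = a
      · exact ⟨b, hk.2.symm, hab.symm, by rw [hla, hmab]⟩
      · exact ⟨l, hl, hla, rfl⟩
  -- The candidates `y` for `k`: those above the minima of all rankings other than `k`.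
  have hext : ∀ k, (k = a ∨ k = b) → ∃ y, (∀ l, l ≠ k → key l (m l) < key l y) ∧
      ∀ z, (∀ l, l ≠ k → key l (m l) < key l z) → key k z ≤ key k y := by
    intro k hk
    have hek : e k ∈ Finset.univ.filter fun y => ∀ l, l ≠ k → key l (m l) < key l y := by
      simp only [Finset.mem_filter, Finset.mem_univ, true_and]
      intro l hl
      exact (hmle l t htτ).trans_lt (hmax l k t hl.symm hte)
    obtain ⟨y, hy, hy'⟩ := Finset.exists_max_image _ (key k) ⟨_, hek⟩
    simp only [Finset.mem_filter, Finset.mem_univ, true_and] at hy hy'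
    exact ⟨y, hy, hy'⟩
  have hgood : ∀ k, (k = a ∨ k = b) → ∀ y, (∀ l, l ≠ k → key l (m l) < key l y) →
      (∀ z, (∀ l, l ≠ k → key l (m l) < key l z) → key k z ≤ key k y) →
      y ∉ τ ∧ Dominant key (insert y τ) := by
    intro k hk y hy hymax
    refine ⟨fun hyτ => ?_, fun z => ?_⟩
    · obtain ⟨l, hl, rfl⟩ := (hpair k).1 hk y hyτ
      exact lt_irrefl _ (hy l hl)
    · by_cases hz : ∀ l, l ≠ k → key l (m l) < key l z
      · obtain ⟨i, hi⟩ := hτ z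
        have hik : i = k := by
          by_contra hik
          exact (hz i hik).not_ge (hi _ (hmτ i))
        subst hik
        refine ⟨i, fun x hx => ?_⟩
        rcases Finset.mem_insert.1 hx with rfl | hx
        · exact hymax z hz
        · exact hi x hx
      · push Not at hz
        obtain ⟨l, hl, hzl⟩ := hz
        refine ⟨l, fun x hx => ?_⟩
        rcases Finset.mem_insert.1 hx with rfl | hx
        · exact hzl.trans (hy l hl).le
        · exact hzl.trans (hmle l x hx)
  obtain ⟨ya, hya, hyamax⟩ := hext a (Or.inl rfl)
  obtain ⟨yb, hyb, hybmax⟩ := hext b (Or.inr rfl)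
  refine ⟨ya, yb, ?_, fun v => ⟨?_, ?_⟩⟩
  · rintro rfl
    obtain ⟨i, hi⟩ := hτ ya
    have hi := hi _ (hmτ i)
    by_cases hia : i = a
    · exact (hyb i (by rw [hia]; exact hab)).not_ge hi
    · exact (hya i hia).not_ge hi
  · rintro ⟨hvτ, hv⟩
    have hne : ∀ x ∈ τ, x ≠ v := fun x hx hxv => hvτ (hxv ▸ hx)
    -- Every `x ∈ τ` is still a minimum after `v` has been added.
    have hx : ∀ x ∈ τ, ∃ l, m l = x ∧ key l x < key l v := by
      intro x hx
      obtain ⟨l, hl⟩ := hv x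
      refine ⟨l, hinj l (le_antisymm (hmle l x hx) (hl _ (Finset.mem_insert_of_mem (hmτ l)))), ?_⟩
      exact lt_of_le_of_ne (hl v (Finset.mem_insert_self _ _)) fun h => hne x hx (hinj l h)
    obtain ⟨k, hk⟩ := hv v
    have hkx : ∀ x ∈ τ, ∀ l, key l x < key l v → l ≠ k := by
      rintro x hx l hl rfl
      exact hl.not_ge (hk x (Finset.mem_insert_of_mem hx))
    have hkab : k = a ∨ k = b := (hpair k).2 fun x hx' => by
      obtain ⟨l, hl, hlt⟩ := hx x hx'
      exact ⟨l, hkx x hx' l hlt, hl⟩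
    have hvk : ∀ l, l ≠ k → key l (m l) < key l v := by
      intro l hl
      by_contra! hle
      refine hspare k l hl.symm fun x hx' => ?_
      obtain ⟨i, hi, hlt⟩ := hx x hx'
      refine ⟨i, hkx x hx' i hlt, ?_, hi⟩
      rintro rfl
      rw [← hi] at hlt
      exact hlt.not_ge hle
    have huniq : ∀ y, (∀ l, l ≠ k → key l (m l) < key l y) →
        (∀ z, (∀ l, l ≠ k → key l (m l) < key l z) → key k z ≤ key k y) → v = y := by
      intro y hy hymax
      obtain ⟨l, hl⟩ := hv y
      have hlk : l = k := by
        by_contra hlk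
        exact (hy l hlk).not_ge (hl _ (Finset.mem_insert_of_mem (hmτ l)))
      subst hlk
      exact hinj l (le_antisymm (hymax v hvk) (hl v (Finset.mem_insert_self _ _)))
    rcases hkab with rfl | rfl
    · exact Or.inl (huniq ya hya hyamax)
    · exact Or.inr (huniq yb hyb hybmax)
  · rintro (rfl | rfl)
    · exact hgood a (Or.inl rfl) _ hya hyamax
    · exact hgood b (Or.inr rfl) _ hyb hybmax

/-- The set of all slack points but `e k` extends to a dominant set in exactly one way, namely by
the `k`-largest point that is not slack. -/
lemma exists_unique_extension {key : I → V → κ} (hinj : ∀ i, Function.Injective (key i)) {e : I → V}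
    (hmin : ∀ i v, key i (e i) ≤ key i v)
    (hmax : ∀ i l v, l ≠ i → v ∉ Set.range e → key i v < key i (e l))
    (hne : ∃ v, v ∉ Set.range e) (k : I) :
    ∃ y, ∀ v, (v ∉ (Finset.univ.erase k).image e ∧
      Dominant key (insert v ((Finset.univ.erase k).image e))) ↔ v = y := by
  classical
  obtain ⟨t, ht⟩ := hne
  obtain ⟨y, hy, hymax⟩ := Finset.exists_max_image
    (Finset.univ.filter fun v => v ∉ Set.range e) (key k) ⟨t, by simpa using ht⟩
  simp only [Finset.mem_filter, Finset.mem_univ, true_and] at hy hymax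
  have hslack : ∀ i, i ≠ k → e i ∈ (Finset.univ.erase k).image e := fun i hi =>
    Finset.mem_image_of_mem _ (by simp [hi])
  refine ⟨y, fun v => ⟨?_, ?_⟩⟩
  · rintro ⟨hv, hdom⟩
    -- A point that is not slack can be bounded by the extended set in the ranking `k` only.
    have hk : ∀ z, z ∉ Set.range e → key k z ≤ key k v := by
      intro z hz
      obtain ⟨i, hi⟩ := hdom z
      by_cases hik : i = k
      · subst hik
        exact hi v (Finset.mem_insert_self _ _)
      · have := hi _ (Finset.mem_insert_of_mem (hslack i hik))
        exact absurd ⟨i, hinj i (le_antisymm (hmin i z) this)⟩ hz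
    have hvr : v ∉ Set.range e := by
      rintro ⟨i, rfl⟩
      by_cases hik : i = k
      · subst hik
        exact hy ⟨i, hinj i (le_antisymm (hmin i y) (hk y hy))⟩
      · exact hv (hslack i hik)
    exact hinj k (le_antisymm (hymax v hvr) (hk y hy))
  · rintro rfl
    refine ⟨fun h => ?_, fun z => ?_⟩
    · obtain ⟨i, -, hi⟩ := Finset.mem_image.1 h
      exact hy ⟨i, hi⟩
    · by_cases hz : ∃ i, i ≠ k ∧ e i = z
      · obtain ⟨i, -, rfl⟩ := hz
        exact ⟨i, fun x _ => hmin i x⟩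
      · refine ⟨k, fun x hx => ?_⟩
        by_cases hzk : z = e k
        · rw [hzk]
          exact hmin k x
        have hzr : z ∉ Set.range e := by
          rintro ⟨i, rfl⟩
          by_cases hik : i = k
          · exact hzk (by rw [hik])
          · exact hz ⟨i, hik, rfl⟩
        rcases Finset.mem_insert.1 hx with rfl | hx
        · exact hymax z hzr
        · obtain ⟨i, hi, rfl⟩ := Finset.mem_image.1 hx
          exact (hmax k i z (Finset.ne_of_mem_erase hi) hzr).le

/-- The supersets of `τ` with one more element that satisfy `p` correspond to the points that one
can add. -/
lemma card_supersets (p : Finset V → Prop) [DecidablePred p] {τ : Finset V} {n : ℕ}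
    (hn : τ.card + 1 = n) (Y : Finset V) (hY : ∀ v, (v ∉ τ ∧ p (insert v τ)) ↔ v ∈ Y) :
    ((Finset.univ.filter fun σ : Finset V => σ.card = n ∧ p σ).filter (τ ⊆ ·)).card = Y.card := by
  have : (Finset.univ.filter fun σ : Finset V => σ.card = n ∧ p σ).filter (τ ⊆ ·)
      = Y.image (insert · τ) := by
    ext σ
    simp only [Finset.mem_filter, Finset.mem_univ, true_and, Finset.mem_image]
    constructor
    · rintro ⟨⟨hσ, hp⟩, hτσ⟩
      have h1 : (σ \ τ).card = 1 := by
        rw [Finset.card_sdiff_of_subset hτσ]; omega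
      obtain ⟨x, hx⟩ := Finset.card_eq_one.1 h1
      have hx' : x ∈ σ \ τ := by simp [hx]
      have he : insert x τ = σ := by
        rw [← Finset.singleton_union, ← hx, Finset.sdiff_union_of_subset hτσ]
      exact ⟨x, (hY x).1 ⟨(Finset.mem_sdiff.1 hx').2, he.symm ▸ hp⟩, he⟩
    · rintro ⟨x, hx, rfl⟩
      obtain ⟨hxτ, hp⟩ := (hY x).2 hx
      exact ⟨⟨by rw [Finset.card_insert_of_notMem hxτ, hn], hp⟩, Finset.subset_insert _ _⟩
  rw [this, Finset.card_image_of_injOn]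
  intro x hx y hy hxy
  have hxτ := ((hY x).2 hx).1
  have : x ∈ insert y τ := by
    have h : insert x τ = insert y τ := hxy
    rw [← h]
    exact Finset.mem_insert_self _ _
  exact (Finset.mem_insert.1 this).resolve_right hxτ

/-- **Scarf's lemma.** Let a finite set be ranked in finitely many ways, and let `e i` be points
such that `e i` is the lowest one in the ranking `i`, and above all points other than these in
the other rankings. Every colouring by the rankings in which `e i` has colour `i` takes all colours
on some dominant set. -/
theorem exists_dominant_colorful {key : I → V → κ} (hinj : ∀ i, Function.Injective (key i))
    {e : I → V} (hmin : ∀ i v, key i (e i) ≤ key i v)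
    (hmax : ∀ i l v, l ≠ i → v ∉ Set.range e → key i v < key i (e l))
    (hne : ∃ v, v ∉ Set.range e) [Nonempty I] {c : V → I} (hc : ∀ i, c (e i) = i) :
    ∃ σ, Dominant key σ ∧ ∀ i, ∃ x ∈ σ, c x = i := by
  classical
  by_contra! hno
  obtain ⟨k⟩ := ‹Nonempty I›
  set R : Finset (Finset V) :=
    Finset.univ.filter fun σ => σ.card = Fintype.card I ∧ Dominant key σ with hR
  set D : Finset (Finset V) := Finset.univ.filter fun τ =>
    Dominant key τ ∧ τ.card + 1 = Fintype.card I ∧ τ.image c = Finset.univ.erase k with hD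
  have hcount := Finset.sum_card_bipartiteAbove_eq_sum_card_bipartiteBelow
    (s := D) (t := R) (fun τ σ => τ ⊆ σ)
  unfold Finset.bipartiteAbove Finset.bipartiteBelow at hcount
  have heven : Even (∑ σ ∈ R, (D.filter (· ⊆ σ)).card) := by
    refine Finset.even_sum _ fun σ hσ => ?_
    simp only [hR, Finset.mem_filter, Finset.mem_univ, true_and] at hσ
    refine even_card_facets (c := c) (k := k) hσ.1 ?_ D fun τ hτ => ?_
    · obtain ⟨i, hi⟩ := hno σ hσ.2
      exact fun h => (h i).elim fun x hx => hi x hx.1 hx.2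
    · simp [hD, hσ.2.mono hτ]
  have he : Function.Injective e := fun i j h => by rw [← hc i, h, hc j]
  have hτ₀card : ((Finset.univ.erase k).image e).card + 1 = Fintype.card I := by
    rw [Finset.card_image_of_injective _ he, Finset.card_erase_add_one (Finset.mem_univ k),
      Finset.card_univ]
  -- The only facet made of slack points is the set of all `e i` with `i ≠ k`.
  have hτ₀ : (Finset.univ.erase k).image e ∈ D := by
    simp only [hD, Finset.mem_filter, Finset.mem_univ, true_and]
    refine ⟨?_, hτ₀card, ?_⟩
    · obtain ⟨y, hy⟩ := exists_unique_extension hinj hmin hmax hne k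
      exact ((hy y).2 rfl).2.mono (Finset.subset_insert _ _)
    · rw [Finset.image_image, (funext hc : c ∘ e = id), Finset.image_id]
  rw [← Finset.add_sum_erase _ _ hτ₀] at hcount
  have hone : (R.filter ((Finset.univ.erase k).image e ⊆ ·)).card = 1 := by
    obtain ⟨y, hy⟩ := exists_unique_extension hinj hmin hmax hne k
    rw [hR, card_supersets (Dominant key) hτ₀card {y} (by simpa using hy), Finset.card_singleton]
  have heven' : Even (∑ τ ∈ D.erase ((Finset.univ.erase k).image e),
      (R.filter (τ ⊆ ·)).card) := by
    refine Finset.even_sum _ fun τ hτ => ?_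
    obtain ⟨hτne, hτ⟩ := Finset.mem_erase.1 hτ
    simp only [hD, Finset.mem_filter, Finset.mem_univ, true_and] at hτ
    obtain ⟨hdom, hcard, himage⟩ := hτ
    obtain ⟨t, ht, hte⟩ : ∃ t ∈ τ, t ∉ Set.range e := by
      by_contra! h
      refine hτne (Finset.eq_of_subset_of_card_le (fun x hx => ?_) (by omega))
      obtain ⟨i, rfl⟩ := h x hx
      have := Finset.mem_image_of_mem c hx
      rw [himage, hc] at this
      exact Finset.mem_image_of_mem _ this
    obtain ⟨y, z, hyz, h⟩ := exists_two_extensions hinj hmax hdom hcard ht hte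
    rw [hR, card_supersets (Dominant key) hcard {y, z} (by simpa using h), Finset.card_pair hyz]
    exact even_two
  rw [hone] at hcount
  rw [← hcount] at heven
  exact (Nat.not_even_iff_odd.2 (Even.one_add heven')) heven

end Scarf

/-! ### Brouwer's fixed point theorem on a simplex -/

namespace Scarf

variable {I : Type*} [Fintype I] [DecidableEq I]

/-- Lattice points of the `m`-fold simplex in `ℕ^I`, together with one slack point for each
coordinate. -/
abbrev GridPoint (I : Type*) [Fintype I] [DecidableEq I] (m : ℕ) : Type _ :=
  {w : I → ℕ // w ∈ Finset.piAntidiag Finset.univ m} ⊕ I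

/-- The `i`-th coordinate of a grid point. The slack point of `l` is given the coordinate `-1`
at `l`, and a coordinate above those of all lattice points elsewhere. -/
def gridCoord (m : ℕ) (i : I) : GridPoint I m → ℤ
  | .inl w => w.1 i
  | .inr l => if l = i then -1 else m + 1

/-- The ranking of the grid points by their `i`-th coordinate, where ties are broken by an
enumeration of the points. -/
noncomputable def gridKey (m : ℕ) (i : I) (v : GridPoint I m) :
    ℤ ×ₗ Fin (Fintype.card (GridPoint I m)) :=
  toLex (gridCoord m i v, Fintype.equivFin _ v)

lemma gridCoord_le_of_gridKey_le {m : ℕ} {i : I} {v w : GridPoint I m}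
    (h : gridKey m i v ≤ gridKey m i w) : gridCoord m i v ≤ gridCoord m i w := by
  rcases Prod.Lex.toLex_le_toLex.1 h with h | h
  · exact h.le
  · exact h.1.le

lemma gridKey_lt_of_gridCoord_lt {m : ℕ} {i : I} {v w : GridPoint I m}
    (h : gridCoord m i v < gridCoord m i w) : gridKey m i v < gridKey m i w :=
  Prod.Lex.toLex_lt_toLex.2 (Or.inl h)

/-- Every colouring of the lattice points of a simplex by the coordinates has a point `w` such that
for each `i`, either `w` is near the face `w i = 0`, or a point of colour `i` is near `w`. -/
lemma exists_near_all_colors [Nonempty I] (m : ℕ) (c : (I → ℕ) → I) :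
    ∃ w : I → ℕ, ∑ i, w i = m ∧ ∀ i, w i ≤ Fintype.card I ∨ ∃ x : I → ℕ, ∑ j, x j = m ∧ c x = i ∧
      ∀ l, x l ≤ w l + Fintype.card I ∧ w l ≤ x l + Fintype.card I := by
  classical
  have hsum : ∀ w : {w : I → ℕ // w ∈ Finset.piAntidiag Finset.univ m}, ∑ i, w.1 i = m :=
    fun w => (Finset.mem_piAntidiag.1 w.2).1
  have hgrid : ∀ w : I → ℕ, ∑ i, w i = m → w ∈ Finset.piAntidiag Finset.univ m := fun w hw =>
    Finset.mem_piAntidiag.2 ⟨hw, fun i _ => Finset.mem_univ i⟩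
  have hrange : ∀ v : GridPoint I m, v ∉ Set.range (Sum.inr : I → GridPoint I m) →
      ∃ w, v = Sum.inl w := by
    rintro (w | l) hv
    · exact ⟨w, rfl⟩
    · exact absurd ⟨l, rfl⟩ hv
  have hinj : ∀ i, Function.Injective (gridKey (I := I) m i) := by
    intro i v w h
    have h' := congrArg (fun z => (ofLex z).2) h
    exact (Fintype.equivFin _).injective h'
  have hmin : ∀ i v, gridKey (I := I) m i (Sum.inr i) ≤ gridKey m i v := by
    rintro i (w | l)
    · refine (gridKey_lt_of_gridCoord_lt ?_).le
      simp only [gridCoord, if_true]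
      omega
    · by_cases hl : l = i
      · rw [hl]
      · refine (gridKey_lt_of_gridCoord_lt ?_).le
        simp only [gridCoord, if_true, if_neg hl]
        omega
  have hmax : ∀ i l v, l ≠ i → v ∉ Set.range (Sum.inr : I → GridPoint I m) →
      gridKey m i v < gridKey m i (Sum.inr l) := by
    intro i l v hl hv
    obtain ⟨w, rfl⟩ := hrange v hv
    refine gridKey_lt_of_gridCoord_lt ?_
    have h1 : w.1 i ≤ m :=
      (Finset.single_le_sum (f := w.1) (fun _ _ => Nat.zero_le _) (Finset.mem_univ i)).trans
        (hsum w).le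
    simp only [gridCoord, if_neg hl]
    omega
  have hvertex : ∀ i₀ : I, ∑ i, (if i = i₀ then m else 0) = m := fun i₀ => by simp
  obtain ⟨i₀⟩ := ‹Nonempty I›
  obtain ⟨σ, hσ, hcol⟩ := exists_dominant_colorful hinj (e := Sum.inr) hmin hmax
    ⟨Sum.inl ⟨_, hgrid _ (hvertex i₀)⟩, by simp⟩ (c := Sum.elim (fun w => c w.1) id) (fun _ => rfl)
  -- For `i ∈ C` the point of colour `i` in `σ` is a lattice point.
  set C : Finset I := Finset.univ.filter fun i => Sum.inr i ∉ σ with hC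
  have hdom : ∀ y, ∃ i ∈ C, ∀ x, Sum.inl x ∈ σ →
      gridKey m i (Sum.inl y) ≤ gridKey m i (Sum.inl x) := by
    intro y
    obtain ⟨i, hi⟩ := hσ (Sum.inl y)
    refine ⟨i, ?_, fun x hx => hi _ hx⟩
    simp only [hC, Finset.mem_filter, Finset.mem_univ, true_and]
    intro hiσ
    have := hinj i (le_antisymm (hi _ hiσ) (hmin i _))
    simp at this
  have hcolC : ∀ i ∈ C, ∃ x, Sum.inl x ∈ σ ∧ c x.1 = i := by
    intro i hi
    simp only [hC, Finset.mem_filter, Finset.mem_univ, true_and] at hi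
    obtain ⟨x | l, hx, hcx⟩ := hcol i
    · exact ⟨x, hx, hcx⟩
    · exact absurd (show Sum.inr i ∈ σ from (show l = i from hcx) ▸ hx) hi
  obtain ⟨l₀, hl₀, -⟩ := hdom ⟨_, hgrid _ (hvertex i₀)⟩
  obtain ⟨w, hwσ, -⟩ := hcolC l₀ hl₀
  have hμ : ∀ i, ∃ k : ℕ, (∀ x, Sum.inl x ∈ σ → k ≤ x.1 i) ∧ ∃ x, Sum.inl x ∈ σ ∧ x.1 i = k := by
    intro i
    obtain ⟨x, hx, hxmin⟩ := Finset.exists_min_image (Finset.univ.filter fun x => Sum.inl x ∈ σ)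
      (fun x : {w : I → ℕ // w ∈ Finset.piAntidiag Finset.univ m} => x.1 i) ⟨w, by simpa using hwσ⟩
    simp only [Finset.mem_filter, Finset.mem_univ, true_and] at hx hxmin
    exact ⟨x.1 i, hxmin, x, hx, rfl⟩
  choose μ hμle hμex using hμ
  have hCcard : C.card ≤ Fintype.card I := Finset.card_le_univ C
  -- Otherwise a lattice point would exceed all minima over `σ` in the coordinates of `C`.
  have hμsum : m < ∑ i ∈ C, (μ i + 1) := by
    by_contra! hle
    set y : I → ℕ := fun i => (if i ∈ C then μ i + 1 else 0) +
      (if i = l₀ then m - ∑ i ∈ C, (μ i + 1) else 0) with hy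
    have hysum : ∑ i, y i = m := by
      simp only [hy, Finset.sum_add_distrib, Finset.sum_ite_mem, Finset.univ_inter,
        Finset.sum_ite_eq', Finset.mem_univ, if_true]
      simp only [Finset.sum_add_distrib] at hle
      omega
    obtain ⟨i, hiC, hi⟩ := hdom ⟨y, hgrid y hysum⟩
    obtain ⟨x, hx, hxμ⟩ := hμex i
    have h1 : ((y i : ℕ) : ℤ) ≤ (x.1 i : ℕ) := gridCoord_le_of_gridKey_le (hi x hx)
    have h2 : μ i + 1 ≤ y i := by simp [hy, hiC]
    omega
  rw [Finset.sum_add_distrib, Finset.sum_const, smul_eq_mul, mul_one] at hμsum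
  have hup : ∀ x, Sum.inl x ∈ σ → ∀ l ∈ C, x.1 l ≤ μ l + Fintype.card I := by
    intro x hx l hl
    have h1 : ∑ i ∈ C, x.1 i ≤ m :=
      (Finset.sum_le_sum_of_subset (Finset.subset_univ C)).trans (hsum x).le
    have h2 := Finset.add_sum_erase C x.1 hl
    have h3 := Finset.add_sum_erase C μ hl
    have h4 : ∑ i ∈ C.erase l, μ i ≤ ∑ i ∈ C.erase l, x.1 i :=
      Finset.sum_le_sum fun i _ => hμle i x hx
    omega
  have hout : ∀ x, Sum.inl x ∈ σ → ∀ l, l ∉ C → x.1 l ≤ Fintype.card I := by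
    intro x hx l hl
    have h1 : x.1 l + ∑ i ∈ C, x.1 i ≤ m := by
      rw [← Finset.sum_insert hl]
      exact (Finset.sum_le_sum_of_subset (Finset.subset_univ _)).trans (hsum x).le
    have h4 : ∑ i ∈ C, μ i ≤ ∑ i ∈ C, x.1 i := Finset.sum_le_sum fun i _ => hμle i x hx
    omega
  have hnear : ∀ x y, Sum.inl x ∈ σ → Sum.inl y ∈ σ → ∀ l, x.1 l ≤ y.1 l + Fintype.card I := by
    intro x y hx hy l
    by_cases hl : l ∈ C
    · have h1 := hup x hx l hl
      have h2 := hμle l y hy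
      omega
    · have := hout x hx l hl
      omega
  refine ⟨w.1, hsum w, fun i => ?_⟩
  by_cases hi : i ∈ C
  · obtain ⟨x, hx, hcx⟩ := hcolC i hi
    exact Or.inr ⟨x.1, hsum x, hcx, fun l => ⟨hnear x w hx hwσ l, hnear w x hwσ hx l⟩⟩
  · exact Or.inl (hout w hwσ i hi)

/-- An approximate fixed point of a self-map of the simplex, without continuity: in each
coordinate in which `w` is not almost zero, some point near `w` is not moved downwards. -/
lemma exists_approx_fixed_point [Nonempty I] {f : (I → ℝ) → I → ℝ}
    (hf : Set.MapsTo f (stdSimplex ℝ I) (stdSimplex ℝ I)) {ε : ℝ} (hε : 0 < ε) :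
    ∃ w ∈ stdSimplex ℝ I, ∀ i, w i ≤ ε ∨ ∃ x ∈ stdSimplex ℝ I, dist x w ≤ ε ∧ x i ≤ f x i := by
  obtain ⟨m, hm⟩ := exists_nat_gt ((Fintype.card I : ℝ) / ε)
  have hm0 : (0 : ℝ) < m := lt_of_le_of_lt (by positivity) hm
  have hmε : (Fintype.card I : ℝ) / m ≤ ε := by
    rw [div_lt_iff₀ hε] at hm
    rw [div_le_iff₀ hm0]
    linarith
  set s : (I → ℕ) → I → ℝ := fun w i => w i / m with hs
  have hsmem : ∀ w : I → ℕ, ∑ i, w i = m → s w ∈ stdSimplex ℝ I := by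
    intro w hw
    refine ⟨fun i => by positivity, ?_⟩
    rw [← Finset.sum_div, ← Nat.cast_sum, hw, div_self hm0.ne']
  have hcol : ∀ w : I → ℕ, ∃ i, ∑ j, w j = m → s w i ≤ f (s w) i := by
    intro w
    by_cases hw : ∑ j, w j = m
    · have hle : ∑ i, s w i ≤ ∑ i, f (s w) i := by
        rw [(hsmem w hw).2, (hf (hsmem w hw)).2]
      obtain ⟨i, -, hi⟩ := Finset.exists_le_of_sum_le Finset.univ_nonempty hle
      exact ⟨i, fun _ => hi⟩
    · exact ⟨Classical.arbitrary I, fun h => absurd h hw⟩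
  choose c hc using hcol
  obtain ⟨w, hw, hnear⟩ := exists_near_all_colors m c
  refine ⟨s w, hsmem w hw, fun i => ?_⟩
  rcases hnear i with hi | ⟨x, hx, rfl, hxw⟩
  · left
    refine le_trans ?_ hmε
    exact div_le_div_of_nonneg_right (by exact_mod_cast hi) hm0.le
  · right
    refine ⟨s x, hsmem x hx, ?_, hc x hx⟩
    rw [dist_pi_le_iff hε.le]
    intro l
    have h1 : (x l : ℝ) ≤ w l + Fintype.card I := by exact_mod_cast (hxw l).1
    have h2 : (w l : ℝ) ≤ x l + Fintype.card I := by exact_mod_cast (hxw l).2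
    refine le_trans ?_ hmε
    rw [Real.dist_eq, ← sub_div, abs_div, abs_of_pos hm0]
    exact div_le_div_of_nonneg_right (abs_le.2 ⟨by linarith, by linarith⟩) hm0.le

end Scarf

/-- **Brouwer's fixed point theorem** for the standard simplex. -/
theorem exists_fixed_point_stdSimplex {I : Type*} [Fintype I] [Nonempty I] {f : (I → ℝ) → I → ℝ}
    (hf : Set.MapsTo f (stdSimplex ℝ I) (stdSimplex ℝ I))
    (hcont : ContinuousOn f (stdSimplex ℝ I)) : ∃ w ∈ stdSimplex ℝ I, f w = w := by
  classical
  choose w hw hw' using fun k : ℕ =>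
    Scarf.exists_approx_fixed_point hf (Nat.one_div_pos_of_nat (α := ℝ) (n := k))
  obtain ⟨a, ha, φ, hφ, hlim⟩ := (isCompact_stdSimplex ℝ I).tendsto_subseq hw
  have hε : Tendsto (fun k => 1 / ((φ k : ℝ) + 1)) atTop (𝓝 0) :=
    (tendsto_one_div_add_atTop_nhds_zero_nat (𝕜 := ℝ)).comp hφ.tendsto_atTop
  have hle : ∀ i, a i ≤ f a i := by
    intro i
    by_contra! hlt
    have hpos : 0 < a i := lt_of_le_of_lt ((hf ha).1 i) hlt
    have hci : ContinuousOn (fun x => f x i) (stdSimplex ℝ I) :=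
      (continuous_apply i).comp_continuousOn hcont
    have hnhds : ∀ᶠ x in 𝓝[stdSimplex ℝ I] a, f x i < x i :=
      (hci a ha).eventually_lt (continuous_apply i).continuousWithinAt hlt
    obtain ⟨δ, hδ, hball⟩ := Metric.mem_nhdsWithin_iff.1 hnhds
    have hai : Tendsto (fun k => w (φ k) i) atTop (𝓝 (a i)) :=
      ((continuous_apply i).tendsto a).comp hlim
    have h1 : ∀ᶠ k in atTop, 1 / ((φ k : ℝ) + 1) < w (φ k) i := hε.eventually_lt hai hpos
    have h2 : ∀ᶠ k in atTop, dist (w (φ k)) a < δ / 2 :=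
      (tendsto_iff_dist_tendsto_zero.1 hlim).eventually_lt_const (by positivity)
    have h3 : ∀ᶠ k in atTop, 1 / ((φ k : ℝ) + 1) < δ / 2 := hε.eventually_lt_const (by positivity)
    obtain ⟨k, h1, h2, h3⟩ := (h1.and (h2.and h3)).exists
    rcases hw' (φ k) i with h | ⟨x, hx, hxw, hxi⟩
    · exact h1.not_ge h
    · have hxa : dist x a < δ := by
        have := dist_triangle x (w (φ k)) a
        linarith
      have hlt' : f x i < x i := hball ⟨Metric.mem_ball.2 hxa, hx⟩
      exact hlt'.not_ge hxi
  refine ⟨a, ha, funext fun i => ?_⟩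
  have hsum : ∑ i, a i = ∑ i, f a i := by rw [ha.2, (hf ha).2]
  exact ((Finset.sum_eq_sum_iff_of_le fun i _ => hle i).1 hsum i (Finset.mem_univ i)).symm

/-! ### Equilibria of concave games -/

namespace StrategicGame

variable {ι : Type} [Fintype ι] [DecidableEq ι] {X : ι → Type} (G : StrategicGame ι X)

/-- The Nikaido–Isoda function: the sum over the players of what each would gain by changing alone
from `s` to its strategy in `y`. -/
def totalGain (s y : (i : ι) → X i) : ℝ :=
  ∑ i, (G.payoff i (Function.update s i (y i)) - G.payoff i s)

lemma totalGain_self (s : (i : ι) → X i) : G.totalGain s s = 0 := by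
  simp [totalGain]

/-- If `s` is not an equilibrium, then a deviation by one player is a profile with a positive total
gain. -/
lemma exists_totalGain_pos {s : (i : ι) → X i} (hs : s ∈ Set.univ.pi G.actions)
    (h : ¬ G.IsPureNash s) : ∃ y ∈ Set.univ.pi G.actions, 0 < G.totalGain s y := by
  simp only [IsPureNash, IsBestResponse, not_forall, not_and] at h
  obtain ⟨i, hi⟩ := h
  obtain ⟨x, hx, hlt⟩ := hi (hs i (Set.mem_univ i))
  rw [not_le] at hlt
  refine ⟨Function.update s i x, ?_, ?_⟩
  · intro j _
    by_cases hj : j = i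
    · subst hj
      simpa using hx
    · simpa [hj] using hs j (Set.mem_univ j)
  · rw [totalGain, Finset.sum_eq_single i]
    · simpa using hlt
    · intro j _ hj
      simp [hj]
    · simp

lemma continuousOn_totalGain [∀ i, TopologicalSpace (X i)]
    (hcont : ∀ i, ContinuousOn (G.payoff i) (Set.univ.pi G.actions))
    {y : (i : ι) → X i} (hy : y ∈ Set.univ.pi G.actions) :
    ContinuousOn (fun s => G.totalGain s y) (Set.univ.pi G.actions) := by
  refine continuousOn_finsetSum _ fun i _ => ContinuousOn.sub ?_ (hcont i)
  refine (hcont i).comp (continuous_id.update i continuous_const).continuousOn fun s hs j _ => ?_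
  by_cases hj : j = i
  · subst hj
    simpa using hy j (Set.mem_univ j)
  · simpa [hj] using hs j (Set.mem_univ j)

variable [∀ i, AddCommGroup (X i)] [∀ i, Module ℝ (X i)]

lemma concaveOn_totalGain (hconv : ∀ i, Convex ℝ (G.actions i)) {s : (i : ι) → X i}
    (hconc : ∀ i, ConcaveOn ℝ (G.actions i) fun x => G.payoff i (Function.update s i x)) :
    ConcaveOn ℝ (Set.univ.pi G.actions) (G.totalGain s) := by
  refine ⟨convex_pi fun i _ => hconv i, fun x hx y hy a b ha hb hab => ?_⟩
  simp only [totalGain, smul_eq_mul, Finset.mul_sum, ← Finset.sum_add_distrib]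
  refine Finset.sum_le_sum fun i _ => ?_
  have := (hconc i).2 (hx i (Set.mem_univ i)) (hy i (Set.mem_univ i)) ha hb hab
  simp only [smul_eq_mul] at this
  have he : G.payoff i s = a * G.payoff i s + b * G.payoff i s := by rw [← add_mul, hab, one_mul]
  simp only [Pi.add_apply, Pi.smul_apply]
  linarith

variable [∀ i, TopologicalSpace (X i)] [∀ i, ContinuousAdd (X i)] [∀ i, ContinuousSMul ℝ (X i)]

/-- A game with finitely many players, nonempty compact convex action sets, and continuous payoffs
that are concave in the own action has a pure-strategy Nash equilibrium. If it had none, then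
finitely many profiles `y k` would suffice to improve on every profile. Sending the weights `w` to
the normalized gains of the `y k` over `∑ k, w k • y k` is a self-map of a simplex, and at its
fixed point concavity would make the total gain of a profile over itself positive. -/
theorem exists_isPureNash (hne : ∀ i, (G.actions i).Nonempty)
    (hcompact : ∀ i, IsCompact (G.actions i)) (hconv : ∀ i, Convex ℝ (G.actions i))
    (hcont : ∀ i, ContinuousOn (G.payoff i) (Set.univ.pi G.actions))
    (hconc : ∀ s ∈ Set.univ.pi G.actions, ∀ i,
      ConcaveOn ℝ (G.actions i) fun x => G.payoff i (Function.update s i x)) :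
    ∃ s, G.IsPureNash s := by
  classical
  by_contra! hno
  set P := Set.univ.pi G.actions with hP
  have hPc : IsCompact P := isCompact_univ_pi hcompact
  have hPconv : Convex ℝ P := convex_pi fun i _ => hconv i
  have hdev : ∀ s, ∃ y ∈ P, s ∈ P → 0 < G.totalGain s y := fun s => by
    by_cases hs : s ∈ P
    · obtain ⟨y, hy, h⟩ := G.exists_totalGain_pos hs (hno s)
      exact ⟨y, hy, fun _ => h⟩
    · obtain ⟨y, hy⟩ := Set.univ_pi_nonempty_iff.2 hne
      exact ⟨y, hy, fun h => absurd h hs⟩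
  choose y hyP hy using hdev
  obtain ⟨t, -, hcover⟩ := hPc.elim_nhdsWithin_subcover (fun z => {s | 0 < G.totalGain s (y z)})
    fun z hz => (G.continuousOn_totalGain hcont (hyP z) z hz).eventually_const_lt (hy z hz)
  have hcover' : ∀ s ∈ P, ∃ k : t, 0 < G.totalGain s (y k) := fun s hs => by
    simpa using hcover hs
  obtain ⟨s₀, hs₀⟩ := Set.univ_pi_nonempty_iff.2 hne
  have : Nonempty t := ⟨(hcover' s₀ hs₀).choose⟩
  set prof : (t → ℝ) → (i : ι) → X i := fun w => ∑ k, w k • y k with hprof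
  have hprofP : Set.MapsTo prof (stdSimplex ℝ t) P := fun w hw =>
    hPconv.sum_mem (fun k _ => hw.1 k) hw.2 fun k _ => hyP k
  have hprofc : Continuous prof :=
    continuous_finsetSum _ fun k _ => (continuous_apply k).smul continuous_const
  set g : (t → ℝ) → t → ℝ := fun w k => max 0 (G.totalGain (prof w) (y k)) with hg
  have hg0 : ∀ w k, 0 ≤ g w k := fun w k => le_max_left _ _
  have hgc : ∀ k, ContinuousOn (fun w => g w k) (stdSimplex ℝ t) := fun k =>
    continuousOn_const.sup
      ((G.continuousOn_totalGain hcont (hyP k)).comp hprofc.continuousOn hprofP)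
  have hgpos : ∀ w ∈ stdSimplex ℝ t, 0 < ∑ k, g w k := fun w hw => by
    obtain ⟨k, hk⟩ := hcover' _ (hprofP hw)
    exact Finset.sum_pos' (fun k _ => hg0 w k) ⟨k, Finset.mem_univ k, lt_max_of_lt_right hk⟩
  obtain ⟨w, hw, hfix⟩ := exists_fixed_point_stdSimplex (I := t)
    (f := fun w k => g w k / ∑ l, g w l)
    (fun w hw => ⟨fun k => div_nonneg (hg0 w k) (hgpos w hw).le, by
      rw [← Finset.sum_div, div_self (hgpos w hw).ne']⟩)
    (continuousOn_pi.2 fun k => (hgc k).div (continuousOn_finsetSum _ fun l _ => hgc l)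
      fun w hw => (hgpos w hw).ne')
  have hgain : ∀ k, 0 < w k → 0 < G.totalGain (prof w) (y k) := by
    intro k hk
    rw [← congrFun hfix k] at hk
    have h1 : 0 < g w k := by
      by_contra! h
      rw [le_antisymm h (hg0 w k), zero_div] at hk
      exact lt_irrefl _ hk
    exact (lt_max_iff.1 h1).resolve_left (lt_irrefl _)
  have hjensen : ∑ k, w k • G.totalGain (prof w) (y k) ≤ G.totalGain (prof w) (prof w) :=
    (G.concaveOn_totalGain hconv (hconc _ (hprofP hw))).le_map_sum (fun k _ => hw.1 k) hw.2
      fun k _ => hyP k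
  rw [G.totalGain_self] at hjensen
  obtain ⟨k, -, hk⟩ : ∃ k ∈ Finset.univ, 0 < w k :=
    Finset.exists_lt_of_sum_lt (f := fun _ => (0 : ℝ))
      (by rw [hw.2, Finset.sum_const_zero]; exact one_pos)
  refine hjensen.not_gt (Finset.sum_pos' (fun l _ => ?_) ⟨k, Finset.mem_univ k,
    mul_pos hk (hgain k hk)⟩)
  rcases (hw.1 l).eq_or_lt with h | h
  · rw [← h, zero_smul]
  · exact (mul_pos h (hgain l h)).le

end StrategicGame

/-! ### The power-allocation game -/

namespace SectorAntenna

lemma minGain_pos (A : SectorAntenna) : 0 < A.minGain := by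
  have h := mul_pos A.ratio_pos A.width_pos
  have := A.width_le
  exact inv_pos.2 (by linarith)

lemma gain_pos (A : SectorAntenna) (θ : ℝ) : 0 < A.gain θ := by
  unfold gain
  split_ifs
  · exact mul_pos A.ratio_pos A.minGain_pos
  · exact A.minGain_pos

end SectorAntenna

namespace Network

variable {M K : ℕ} (N : Network M K)

lemma noise_pos : 0 < N.noise := mul_pos N.N₀_pos N.W_pos

lemma linkGain_nonneg (h : Fin K → Fin M → ℝ) (j : Fin K) (i : Fin M) : 0 ≤ N.linkGain h j i :=
  mul_nonneg (mul_nonneg (mul_nonneg (N.antennaUE.gain_pos _).le (N.antennaBS.gain_pos _).le)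
    (by positivity)) (Real.rpow_nonneg (N.dist_pos j i).le _)

variable (sel : N.Schedule) (h : Fin K → Fin M → ℝ) (α lam : Fin M → ℝ)

/-- Interference plus noise is positive when all powers are nonnegative. -/
lemma interference_pos {p : N.Profile} (hp : ∀ i j, 0 ≤ p i j) (i : Fin M) (j : N.UEs i) :
    0 < ∑ ℓ ∈ (N.interferers j).erase i, p ℓ (sel ℓ) * N.linkGain h j ℓ + N.noise :=
  add_pos_of_nonneg_of_pos
    (Finset.sum_nonneg fun ℓ _ => mul_nonneg (hp ℓ _) (N.linkGain_nonneg h j ℓ)) N.noise_pos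

lemma equivGain_nonneg {p : N.Profile} (hp : ∀ i j, 0 ≤ p i j) (i : Fin M) (j : N.UEs i) :
    0 ≤ N.equivGain sel h p i j :=
  div_nonneg (N.linkGain_nonneg h j i) (N.interference_pos sel h hp i j).le

/-- The channel that a base station faces does not depend on its own powers. -/
lemma equivGain_update (p : N.Profile) (i : Fin M) (q : N.UEs i → ℝ) (j : N.UEs i) :
    N.equivGain sel h (Function.update p i q) i j = N.equivGain sel h p i j := by
  unfold equivGain
  congr 2
  refine Finset.sum_congr rfl fun ℓ hℓ => ?_
  rw [Function.update_of_ne (Finset.ne_of_mem_erase hℓ)]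

lemma continuousOn_payoff (i : Fin M) :
    ContinuousOn (N.payoff sel h α lam i) {p | ∀ i j, 0 ≤ p i j} := by
  have hc : ∀ (i : Fin M) (j : N.UEs i), Continuous fun p : N.Profile => p i j := fun i j =>
    (continuous_apply j).comp (continuous_apply i)
  unfold payoff sinr equivGain
  refine ContinuousOn.sub (continuousOn_const.mul (continuousOn_finsetSum _ fun j _ =>
    continuousOn_const.mul (ContinuousOn.log (continuousOn_const.add (ContinuousOn.mul
      (ContinuousOn.div continuousOn_const ?_ ?_) (hc i j).continuousOn)) ?_))) ?_
  · exact ((continuous_finsetSum _ fun ℓ _ => (hc ℓ _).mul continuous_const).add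
      continuous_const).continuousOn
  · exact fun p hp => (N.interference_pos sel h hp i j).ne'
  · intro p hp
    have := mul_nonneg (N.equivGain_nonneg sel h hp i j) (hp i j)
    unfold equivGain at this
    positivity
  · exact (continuous_const.mul (continuous_finsetSum _ fun j _ => hc i j)).continuousOn

lemma concaveOn_payoff {i : Fin M} (hα : 0 ≤ α i) {p : N.Profile} (hp : ∀ i j, 0 ≤ p i j) :
    ConcaveOn ℝ {q : N.UEs i → ℝ | ∀ j, 0 ≤ q j}
      fun q => N.payoff sel h α lam i (Function.update p i q) := by
  simp only [payoff, sinr, equivGain_update, Function.update_self]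
  refine ⟨fun x hx y hy a b ha hb _ j => add_nonneg (mul_nonneg ha (hx j)) (mul_nonneg hb (hy j)),
    fun x hx y hy a b ha hb hab => ?_⟩
  have hlog : ∀ j, a * Real.log (1 + N.equivGain sel h p i j * x j) +
      b * Real.log (1 + N.equivGain sel h p i j * y j) ≤
      Real.log (1 + N.equivGain sel h p i j * (a * x j + b * y j)) := by
    intro j
    have hg := N.equivGain_nonneg sel h hp i j
    have h1 : 0 < 1 + N.equivGain sel h p i j * x j := by
      have := mul_nonneg hg (hx j)
      positivity
    have h2 : 0 < 1 + N.equivGain sel h p i j * y j := by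
      have := mul_nonneg hg (hy j)
      positivity
    have := strictConcaveOn_log_Ioi.concaveOn.2 h1 h2 ha hb hab
    simp only [smul_eq_mul] at this
    refine this.trans_eq (congrArg Real.log ?_)
    linear_combination hab
  have hsum : a * (∑ j, N.W * Real.log (1 + N.equivGain sel h p i j * x j)) +
      b * (∑ j, N.W * Real.log (1 + N.equivGain sel h p i j * y j)) ≤
      ∑ j, N.W * Real.log (1 + N.equivGain sel h p i j * (a * x j + b * y j)) := by
    rw [Finset.mul_sum, Finset.mul_sum, ← Finset.sum_add_distrib]
    refine Finset.sum_le_sum fun j _ => ?_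
    have := mul_le_mul_of_nonneg_left (hlog j) N.W_pos.le
    linarith
  have hα' := mul_le_mul_of_nonneg_left hsum hα
  have hprice : lam i * ∑ j, (a * x j + b * y j) =
      a * (lam i * ∑ j, x j) + b * (lam i * ∑ j, y j) := by
    rw [Finset.sum_add_distrib, ← Finset.mul_sum, ← Finset.mul_sum]
    ring
  simp only [Pi.add_apply, Pi.smul_apply, smul_eq_mul]
  linarith

lemma convex_powerSet (i : Fin M) : Convex ℝ (N.powerSet i) := by
  rintro x ⟨⟨-, hx⟩, hx0⟩ y ⟨⟨-, hy⟩, hy0⟩ a b ha hb hab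
  have h0 : ∀ j, 0 ≤ (a • x + b • y) j := fun j =>
    add_nonneg (mul_nonneg ha (hx0 j)) (mul_nonneg hb (hy0 j))
  refine ⟨⟨Finset.sum_nonneg fun j _ => h0 j, ?_⟩, h0⟩
  simp only [Pi.add_apply, Pi.smul_apply, smul_eq_mul, Finset.sum_add_distrib, ← Finset.mul_sum]
  calc a * ∑ j, x j + b * ∑ j, y j ≤ a * N.pmax i + b * N.pmax i :=
        add_le_add (mul_le_mul_of_nonneg_left hx ha) (mul_le_mul_of_nonneg_left hy hb)
    _ = N.pmax i := by rw [← add_mul, hab, one_mul]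

lemma isCompact_powerSet (i : Fin M) : IsCompact (N.powerSet i) := by
  have hs : Continuous fun q : N.UEs i → ℝ => ∑ j, q j :=
    continuous_finsetSum _ fun j _ => continuous_apply j
  refine (isCompact_Icc (a := (0 : N.UEs i → ℝ)) (b := fun _ => N.pmax i)).of_isClosed_subset ?_ ?_
  · refine ((isClosed_le continuous_const hs).inter (isClosed_le hs continuous_const)).inter ?_
    exact isClosed_Ici (a := (0 : N.UEs i → ℝ))
  · rintro q ⟨⟨-, hq⟩, hq0⟩
    exact ⟨hq0, fun j => (Finset.single_le_sum (fun k _ => hq0 k) (Finset.mem_univ j)).trans hq⟩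

lemma zero_mem_powerSet (i : Fin M) : (0 : N.UEs i → ℝ) ∈ N.powerSet i := by
  simp [powerSet, N.pmax_nonneg i]

/-- The power-allocation game has an equilibrium for all nonempty closed convex restrictions of the
action spaces. -/
theorem exists_isPureNash_of_subset {A : (i : Fin M) → Set (N.UEs i → ℝ)} (hα : ∀ i, 0 ≤ α i)
    (hA : ∀ i, A i ⊆ N.powerSet i) (hne : ∀ i, (A i).Nonempty) (hclosed : ∀ i, IsClosed (A i))
    (hconv : ∀ i, Convex ℝ (A i)) :
    ∃ p : N.Profile, (⟨A, N.payoff sel h α lam⟩ : StrategicGame _ _).IsPureNash p := by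
  have hpos : Set.univ.pi A ⊆ {p : N.Profile | ∀ i j, 0 ≤ p i j} := fun p hp i =>
    (hA i (hp i (Set.mem_univ i))).2
  refine StrategicGame.exists_isPureNash _ hne
    (fun i => (N.isCompact_powerSet i).of_isClosed_subset (hclosed i) (hA i)) hconv
    (fun i => (N.continuousOn_payoff sel h α lam i).mono hpos)
    fun p hp i => (N.concaveOn_payoff sel h α lam (hα i) (hpos hp)).subset
      (fun q hq => (hA i hq).2) (hconv i)

end Network

theorem lemma2 {M K : ℕ} (N : Network M K) (sel : N.Schedule) (h : Fin K → Fin M → ℝ)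
    (α lam : Fin M → ℝ) (hα : ∀ i, 0 ≤ α i) (hlam : ∀ i, 0 ≤ lam i) :
    (∃ p : N.Profile, (N.powerGame sel h α lam).IsPureNash p) ∧
      (∃ p : N.Profile, (N.scheduledGame sel h α lam).IsPureNash p) := by
  have hsched : ∀ i, IsClosed {q : N.UEs i → ℝ | ∀ j, j ≠ sel i → q j = 0} := fun i => by
    simp only [Set.ofPred_forall]
    exact isClosed_iInter fun j => isClosed_iInter fun _ =>
      isClosed_eq (continuous_apply j) continuous_const
  refine ⟨N.exists_isPureNash_of_subset sel h α lam hα (fun i => subset_rfl)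
    (fun i => ⟨0, N.zero_mem_powerSet i⟩) (fun i => (N.isCompact_powerSet i).isClosed)
    N.convex_powerSet, N.exists_isPureNash_of_subset sel h α lam hα (fun i q hq => hq.1)
    (fun i => ⟨0, N.zero_mem_powerSet i, fun _ _ => rfl⟩)
    (fun i => (N.isCompact_powerSet i).isClosed.inter (hsched i))
    fun i => (N.convex_powerSet i).inter ?_⟩
  intro x hx y hy a b _ _ _ j hj
  simp [hx j hj, hy j hj]
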